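/- An interval exchange transformation (IET) is a bijection $f:[0,1)\to[0,1)$ for which there is a finite partition of $[0,1)$ into half-open intervals $[a,b)$ on each of which $f$ is a translation. For $\alpha\in\mathbb R$ the rotation $R_\alpha$ is the IET $x\mapsto x+\alpha \bmod 1$; it is irrational if $\alpha\notin\mathbb Q$. For an integer $n\ge 1$ let $G_n$ be the set of IETs that map each of the intervals $I_i=[\frac{i-1}{n},\frac in)$, $1\le i\le n$, onto one of these intervals, and whose restriction to each $I_i$ has at most one discontinuity in the interior of $I_i$. A map is periodic-point free if no point is fixed by a positive iterate of it. Let $f$ and $g$ be IETs, and suppose that one of the following holds: (1) $f$ is an irrational rotation and $g$ is not a rotation; (2) for some integer $n\ge1$, $f\in G_n$ is periodic-point free and $g\notin G_n$. Then the group $\langle f,g\rangle$ generated by $f$ and $g$ is not virtually nilpotent, that is, it has no nilpotent subgroup of finite index. -/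

import Mathlib

namespace IET

/-- The half-open unit interval `[0,1)`. -/
abbrev I01 : Type := Set.Ico (0 : ℝ) 1

/-- `ExchangesOn f a b r`: the interval `[a,b)` is cut into `r` consecutive nonempty half-open
intervals `[c 0, c 1), ..., [c (r-1), c r)`, with `c 0 = a` and `c r = b`, on each of which the
bijection `f` is a translation. Since `f` is a bijection, it thus reorders these intervals. -/
def ExchangesOn (f : Equiv.Perm I01) (a b : ℝ) (r : ℕ) : Prop :=
  ∃ (c : Fin (r + 1) → ℝ) (t : Fin r → ℝ),
    StrictMono c ∧ c 0 = a ∧ c (Fin.last r) = b ∧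
      ∀ (i : Fin r) (x : I01), c i.castSucc ≤ (x : ℝ) → (x : ℝ) < c i.succ →
        (f x : ℝ) = (x : ℝ) + t i

/-- Interval exchange transformations of `[0,1)`. -/
def IsIET (f : Equiv.Perm I01) : Prop :=
  ∃ r : ℕ, ExchangesOn f 0 1 r

/-- `f` is the circular rotation `R_α : x ↦ x + α mod 1` of `[0,1)`. -/
def IsRotationBy (α : ℝ) (f : Equiv.Perm I01) : Prop :=
  ∀ x : I01, (f x : ℝ) = Int.fract ((x : ℝ) + α)

/-- `f` is a circular rotation. -/
def IsRotation (f : Equiv.Perm I01) : Prop :=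
  ∃ α : ℝ, IsRotationBy α f

/-- `f` is a circular rotation of irrational angle. -/
def IsIrrationalRotation (f : Equiv.Perm I01) : Prop :=
  ∃ α : ℝ, Irrational α ∧ IsRotationBy α f

/-- The `i`-th interval (counted from `0`) `[i/n, (i+1)/n)` of the partition of `[0,1)` into `n`
intervals of the same length. -/
def cell (n : ℕ) (i : Fin n) : Set I01 :=
  {x | (i : ℝ) / n ≤ (x : ℝ) ∧ (x : ℝ) < ((i : ℝ) + 1) / n}

/-- `G_n`: the interval exchange transformations that preserve the partition of `[0,1)` into the
`n` intervals `[i/n, (i+1)/n)`, mapping each of them onto one of them, and whose restriction to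
each of them has at most one interior discontinuity, that is, is an exchange of at most two
half-open intervals (a rotation of that interval, followed by a translation). -/
def G (n : ℕ) : Set (Equiv.Perm I01) :=
  {f | IsIET f ∧ ∀ i : Fin n,
    (∃ j : Fin n, f '' cell n i = cell n j) ∧
      ∃ r ≤ 2, ExchangesOn f ((i : ℝ) / n) (((i : ℝ) + 1) / n) r}

/-- `f` has no periodic point. -/
def PeriodicPointFree (f : Equiv.Perm I01) : Prop :=
  Function.periodicPts f = ∅

end IET

namespace IET

/-! Let `S` be `cellGroup n`: the maps that permute the `n` cells and rotate each of them. For `n =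
1` these are the rotations; in general its IETs are the elements of `G n`, so both cases ask for `g
∈ S`.

The core is a rigidity property (`mem_cellGroup_of_conj`). Some power of a periodic-point-free `f ∈
S` rotates every cell by an irrational angle, hence minimally. If a piecewise translation `h`
conjugates a positive power of `f` into `S`, then the cell containing `h x` and, up to finite order,
the displacement of `h` mod `1/n` are invariant along minimal rotations, hence constant on cells; so
`h ∈ S`.

The rest is group theory (`eq_top_of_isVirtuallyNilpotent`). In a virtually nilpotent group this
property climbs the upper central series of a finite-index nilpotent subgroup, then passes to the
whole group, forcing `g ∈ S`. -/

lemma fract_eq_of_sub_eq {u v : ℝ} (z : ℤ) (h : u - v = z) : Int.fract u = Int.fract v :=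
  Int.fract_eq_fract.2 ⟨z, h⟩

lemma mem_cell_iff {n : ℕ} (hn : 0 < n) {i : Fin n} {x : I01} :
    x ∈ cell n i ↔ (i : ℝ) ≤ n * (x : ℝ) ∧ n * (x : ℝ) < i + 1 := by
  have h : (0 : ℝ) < n := by exact_mod_cast hn
  simp only [cell, Set.mem_ofPred_eq, div_le_iff₀ h, lt_div_iff₀ h, mul_comm]

lemma exists_mem_cell {n : ℕ} (hn : 0 < n) (x : I01) : ∃ i, x ∈ cell n i := by
  have h : (0 : ℝ) < n := by exact_mod_cast hn
  have h0 : (0 : ℝ) ≤ n * (x : ℝ) := mul_nonneg h.le x.2.1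
  have h1 : n * (x : ℝ) < n := by nlinarith [x.2.2]
  refine ⟨⟨⌊n * (x : ℝ)⌋₊, (Nat.floor_lt h0).2 h1⟩, (mem_cell_iff hn).2 ⟨?_, ?_⟩⟩
  · exact Nat.floor_le h0
  · exact Nat.lt_floor_add_one _

lemma cell_unique {n : ℕ} (hn : 0 < n) {i j : Fin n} {x : I01} (hi : x ∈ cell n i)
    (hj : x ∈ cell n j) : i = j := by
  rw [mem_cell_iff hn] at hi hj
  have h1 : ((i : ℕ) : ℝ) < (j : ℕ) + 1 := hi.1.trans_lt hj.2
  have h2 : ((j : ℕ) : ℝ) < (i : ℕ) + 1 := hj.1.trans_lt hi.2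
  norm_cast at h1 h2
  ext
  omega

lemma exists_cell_point {n : ℕ} (hn : 0 < n) (i : Fin n) (u : ℝ) :
    ∃ x : I01, n * (x : ℝ) = i + Int.fract u := by
  have h : (0 : ℝ) < n := by exact_mod_cast hn
  have hi : ((i : ℕ) : ℝ) + 1 ≤ n := by exact_mod_cast i.2
  refine ⟨⟨(i + Int.fract u) / n, ?_, ?_⟩, ?_⟩
  · have := Int.fract_nonneg u
    positivity
  · rw [div_lt_one h]
    linarith [Int.fract_lt_one u]
  · field_simp

lemma mem_cell_of_eq {n : ℕ} (hn : 0 < n) {i : Fin n} {x : I01} {u : ℝ}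
    (h : n * (x : ℝ) = i + Int.fract u) : x ∈ cell n i := by
  rw [mem_cell_iff hn, h]
  exact ⟨by linarith [Int.fract_nonneg u], by linarith [Int.fract_lt_one u]⟩

lemma fract_of_mem_cell {n : ℕ} (hn : 0 < n) {i : Fin n} {x : I01} (h : x ∈ cell n i) :
    Int.fract (n * (x : ℝ)) = n * x - i := by
  rw [mem_cell_iff hn] at h
  rw [Int.fract_eq_iff]
  exact ⟨by linarith, by linarith, i, by push_cast; ring⟩

lemma eq_of_mul_eq {n : ℕ} (hn : 0 < n) {x y : I01} (h : n * (x : ℝ) = n * y) : x = y := by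
  have h0 : (n : ℝ) ≠ 0 := by exact_mod_cast hn.ne'
  exact Subtype.ext (mul_left_cancel₀ h0 h)

/-! ### Maps that rotate and permute the cells -/

/-- `h` maps the `i`-th cell onto the `σ i`-th one by a rotation of angle `a i / n` followed by a
translation. -/
def CellAct (n : ℕ) (σ : Equiv.Perm (Fin n)) (a : Fin n → ℝ) (h : Equiv.Perm I01) : Prop :=
  ∀ (i : Fin n) (x : I01), x ∈ cell n i → n * (h x : ℝ) = σ i + Int.fract (n * (x : ℝ) + a i)

lemma CellAct.mem {n : ℕ} (hn : 0 < n) {σ : Equiv.Perm (Fin n)} {a : Fin n → ℝ}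
    {h : Equiv.Perm I01} (H : CellAct n σ a h) {i : Fin n} {x : I01} (hx : x ∈ cell n i) :
    h x ∈ cell n (σ i) :=
  mem_cell_of_eq hn (H i x hx)

lemma CellAct.one {n : ℕ} (hn : 0 < n) : CellAct n 1 0 1 := by
  intro i x hx
  simp [fract_of_mem_cell hn hx]

lemma CellAct.mul {n : ℕ} (hn : 0 < n) {σ τ : Equiv.Perm (Fin n)} {a b : Fin n → ℝ}
    {h k : Equiv.Perm I01} (H : CellAct n σ a h) (K : CellAct n τ b k) :
    CellAct n (σ * τ) (fun i => b i + a (τ i)) (h * k) := by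
  intro i x hx
  rw [Equiv.Perm.mul_apply, H _ _ (K.mem hn hx), Equiv.Perm.mul_apply, K i x hx]
  congr 1
  refine fract_eq_of_sub_eq ((τ i : ℕ) - ⌊n * (x : ℝ) + b i⌋) ?_
  rw [Int.fract]
  push_cast
  ring

lemma CellAct.inv {n : ℕ} (hn : 0 < n) {σ : Equiv.Perm (Fin n)} {a : Fin n → ℝ}
    {h : Equiv.Perm I01} (H : CellAct n σ a h) :
    CellAct n σ⁻¹ (fun i => -a (σ⁻¹ i)) h⁻¹ := by
  intro i y hy
  obtain ⟨x, hx⟩ := exists_cell_point hn (σ⁻¹ i) (n * (y : ℝ) + -a (σ⁻¹ i))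
  have hxy : h x = y := by
    apply eq_of_mul_eq hn
    rw [H _ _ (mem_cell_of_eq hn hx), hx, Equiv.Perm.coe_inv, Equiv.apply_symm_apply]
    have := fract_of_mem_cell hn hy
    rw [← eq_sub_iff_add_eq', ← this]
    refine fract_eq_of_sub_eq ((σ⁻¹ i : ℕ) - ⌊n * (y : ℝ) + -a (σ⁻¹ i)⌋) ?_
    rw [Int.fract]
    push_cast
    simp only [Equiv.Perm.coe_inv]
    ring
  rw [← hx, ← hxy, Equiv.Perm.coe_inv, Equiv.symm_apply_apply]

lemma CellAct.pow_perm {n : ℕ} (hn : 0 < n) {σ : Equiv.Perm (Fin n)} {a : Fin n → ℝ}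
    {h : Equiv.Perm I01} (H : CellAct n σ a h) (k : ℕ) : ∃ b, CellAct n (σ ^ k) b (h ^ k) := by
  induction k with
  | zero => exact ⟨0, CellAct.one hn⟩
  | succ k ih =>
    obtain ⟨b, hb⟩ := ih
    rw [pow_succ, pow_succ]
    exact ⟨_, hb.mul hn H⟩

lemma CellAct.pow {n : ℕ} (hn : 0 < n) {a : Fin n → ℝ} {F : Equiv.Perm I01}
    (H : CellAct n 1 a F) (k : ℕ) : CellAct n 1 (fun i => k * a i) (F ^ k) := by
  induction k with
  | zero =>
    intro i x hx
    simp [fract_of_mem_cell hn hx]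
  | succ k ih =>
    intro i x hx
    rw [pow_succ, ih.mul hn H i x hx, mul_one, Equiv.Perm.one_apply]
    push_cast
    simp only [id]
    ring_nf

/-- The group of bijections permuting the cells and acting on each of them by a rotation. -/
def cellGroup (n : ℕ) (hn : 0 < n) : Subgroup (Equiv.Perm I01) where
  carrier := {h | ∃ σ a, CellAct n σ a h}
  one_mem' := ⟨1, 0, CellAct.one hn⟩
  mul_mem' := by
    rintro h k ⟨σ, a, H⟩ ⟨τ, b, K⟩
    exact ⟨_, _, H.mul hn K⟩
  inv_mem' := by
    rintro h ⟨σ, a, H⟩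
    exact ⟨_, _, H.inv hn⟩

/-! ### Piecewise translations -/

/-- The group of bijections that are translations to the right of each point, with finitely many
displacements. -/
def locTrans : Subgroup (Equiv.Perm I01) where
  carrier := {h | (∀ x : I01, ∃ ε > 0, ∀ y : I01, (x : ℝ) ≤ y → (y : ℝ) < x + ε →
    (h y : ℝ) - y = h x - x) ∧ (Set.range fun x : I01 => (h x : ℝ) - x).Finite}
  one_mem' := by
    refine ⟨fun x => ⟨1, one_pos, fun y _ _ => by simp⟩, ?_⟩
    simp only [Equiv.Perm.one_apply, sub_self]
    exact Set.finite_range_const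
  mul_mem' := by
    rintro h k ⟨h1, h2⟩ ⟨k1, k2⟩
    constructor
    · intro x
      obtain ⟨ε, hε, H⟩ := h1 (k x)
      obtain ⟨δ, hδ, K⟩ := k1 x
      refine ⟨min ε δ, lt_min hε hδ, fun y hy hy' => ?_⟩
      have e1 := K y hy (hy'.trans_le (by gcongr; exact min_le_right _ _))
      have hy2 : (y : ℝ) < x + ε := hy'.trans_le (by gcongr; exact min_le_left _ _)
      have e2 := H (k y) (by linarith) (by linarith)
      simp only [Equiv.Perm.mul_apply]
      linarith
    · refine (h2.add k2).subset ?_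
      rintro _ ⟨x, rfl⟩
      refine Set.mem_add.2 ⟨_, ⟨k x, rfl⟩, _, ⟨x, rfl⟩, ?_⟩
      simp
  inv_mem' := by
    rintro h ⟨h1, h2⟩
    constructor
    · intro y
      obtain ⟨x, rfl⟩ := h.surjective y
      obtain ⟨ε, hε, H⟩ := h1 x
      have hx1 : (0 : ℝ) < 1 - x := sub_pos.2 x.2.2
      -- The bound `1 - x` keeps the candidate preimage `w` below `1`.
      refine ⟨min ε (1 - x), lt_min hε hx1, fun z hz hz' => ?_⟩
      have hz1 : (z : ℝ) < h x + ε := hz'.trans_le (by gcongr; exact min_le_left _ _)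
      have hz2 : (z : ℝ) < h x + (1 - x) := hz'.trans_le (by gcongr; exact min_le_right _ _)
      let w : I01 := ⟨x + (z - h x), by linarith [x.2.1], by linarith⟩
      have hw : (w : ℝ) = x + (z - h x) := rfl
      have e := H w (by linarith) (by linarith)
      have hwz : h w = z := Subtype.ext (by linarith)
      rw [← hwz]
      simp only [Equiv.Perm.coe_inv, Equiv.symm_apply_apply]
      linarith
    · refine h2.neg.subset ?_
      rintro _ ⟨y, rfl⟩
      refine ⟨h⁻¹ y, ?_⟩
      simp

lemma IsIET.mem_locTrans {h : Equiv.Perm I01} (H : IsIET h) : h ∈ locTrans := by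
  obtain ⟨r, c, t, hc, h0, h1, ht⟩ := H
  have key : ∀ x : I01, ∃ i : Fin r, c i.castSucc ≤ x ∧ (x : ℝ) < c i.succ := by
    intro x
    by_contra! hcon
    have : ∀ i : Fin (r + 1), c i ≤ x := by
      intro i
      induction i using Fin.induction with
      | zero => rw [h0]; exact x.2.1
      | succ i ih => exact hcon i ih
    have := this (Fin.last r)
    rw [h1] at this
    exact absurd x.2.2 (not_lt.2 this)
  constructor
  · intro x
    obtain ⟨i, hi, hi'⟩ := key x
    refine ⟨c i.succ - x, sub_pos.2 hi', fun y hy hy' => ?_⟩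
    rw [ht i y (hi.trans hy) (by linarith), ht i x hi hi']
    ring
  · refine (Set.finite_range t).subset ?_
    rintro _ ⟨x, rfl⟩
    obtain ⟨i, hi, hi'⟩ := key x
    exact ⟨i, by simp [ht i x hi hi']⟩

/-! ### Rigidity from minimality of irrational rotations -/

/-- A map invariant under an irrational rotation of a cell and constant to the right of some point
of it is constant on the cell. -/
lemma eq_of_invariant {n : ℕ} (hn : 0 < n) {a : Fin n → ℝ} {F : Equiv.Perm I01}
    (HF : CellAct n 1 a F) {i : Fin n} (ha : Irrational (a i)) {β : Type*} (φ : I01 → β)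
    (hφ : ∀ x ∈ cell n i, φ (F x) = φ x) {x₀ : I01} (hx₀ : x₀ ∈ cell n i) {ε : ℝ} (hε : 0 < ε)
    (hloc : ∀ y ∈ cell n i, (x₀ : ℝ) ≤ y → (y : ℝ) < x₀ + ε → φ y = φ x₀) {x : I01}
    (hx : x ∈ cell n i) : φ x = φ x₀ := by
  have hn' : (0 : ℝ) < n := by exact_mod_cast hn
  have hpow : ∀ (k : ℕ) (y : I01), y ∈ cell n i → φ ((F ^ k) y) = φ y := by
    intro k
    induction k with
    | zero => simp
    | succ k ih =>
      intro y hy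
      rw [pow_succ, Equiv.Perm.mul_apply, ih _ (HF.mem hn hy), hφ y hy]
  have hx₀' := (mem_cell_iff hn).1 hx₀
  have hd : Dense (AddSubgroup.closure {a i, 1} : Set ℝ) := by
    rw [dense_addSubgroupClosure_pair_iff]
    simpa using ha
  have hlt : n * (x₀ : ℝ) < min (n * (x₀ : ℝ) + n * ε) (i + 1) :=
    lt_min (by linarith [mul_pos hn' hε]) hx₀'.2
  -- Density gives a shift `k * a i + l` that carries `n * x` just to the right of `n * x₀`, still
  -- inside the cell.
  obtain ⟨u, hu, hu1, hu2⟩ := hd.exists_between (sub_lt_sub_right hlt (n * (x : ℝ)))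
  rw [SetLike.mem_coe, AddSubgroup.mem_closure_pair] at hu
  obtain ⟨k, l, rfl⟩ := hu
  simp only [zsmul_eq_mul, mul_one] at hu1 hu2
  have hm1 : n * (x : ℝ) + (k * a i + l) < n * x₀ + n * ε := by
    linarith [min_le_left (n * (x₀ : ℝ) + n * ε) (i + 1)]
  have hm2 : n * (x : ℝ) + (k * a i + l) < i + 1 := by
    linarith [min_le_right (n * (x₀ : ℝ) + n * ε) (i + 1)]
  obtain ⟨y, hy⟩ := exists_cell_point hn i (n * (x : ℝ) + (k * a i + l))
  have hyc := mem_cell_of_eq hn hy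
  have hy' : n * (y : ℝ) = n * (x : ℝ) + (k * a i + l) := by
    rw [hy, ← eq_sub_iff_add_eq', Int.fract_eq_iff]
    exact ⟨by linarith, by linarith, i, by push_cast; ring⟩
  have hyφ : φ y = φ x₀ := by
    refine hloc y hyc ?_ ?_
    · refine le_of_mul_le_mul_left ?_ hn'
      linarith
    · refine lt_of_mul_lt_mul_left ?_ hn'.le
      linarith
  rw [← hyφ]
  -- For negative `k` the orbit is followed from `y` to `x` instead.
  obtain ⟨m, rfl | rfl⟩ := k.eq_nat_or_neg
  · have : (F ^ m) x = y := by
      apply eq_of_mul_eq hn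
      rw [HF.pow hn m i x hx, Equiv.Perm.one_apply, ← eq_sub_iff_add_eq',
        ← fract_of_mem_cell hn hyc]
      refine fract_eq_of_sub_eq (-l) ?_
      rw [hy']
      push_cast
      ring
    rw [← this, hpow m x hx]
  · have : (F ^ m) y = x := by
      apply eq_of_mul_eq hn
      rw [HF.pow hn m i y hyc, Equiv.Perm.one_apply, ← eq_sub_iff_add_eq',
        ← fract_of_mem_cell hn hx]
      refine fract_eq_of_sub_eq l ?_
      rw [hy']
      push_cast
      ring
    rw [← this, hpow m y hyc]

lemma PeriodicPointFree.pow {f : Equiv.Perm I01} (hf : PeriodicPointFree f) {k : ℕ} (hk : 0 < k)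
    (x : I01) : (f ^ k) x ≠ x := by
  intro h
  have : x ∈ Function.periodicPts f :=
    Function.mk_mem_periodicPts hk (by
      rw [Function.IsPeriodicPt, Function.IsFixedPt, Equiv.Perm.iterate_eq_pow, h])
  rw [hf] at this
  exact this

/-- If the angle were a rational `q`, then `F ^ q.den` would fix the points of the cell. -/
lemma CellAct.irrational {n : ℕ} (hn : 0 < n) {a : Fin n → ℝ} {F : Equiv.Perm I01}
    (HF : CellAct n 1 a F) (hF : ∀ k : ℕ, 0 < k → ∀ x : I01, (F ^ k) x ≠ x) (i : Fin n) :
    Irrational (a i) := by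
  rintro ⟨q, hq⟩
  obtain ⟨x, hx⟩ := exists_cell_point hn i 0
  have hxc := mem_cell_of_eq hn hx
  refine hF q.den q.den_pos x (eq_of_mul_eq hn ?_)
  rw [HF.pow hn q.den i x hxc, Equiv.Perm.one_apply, ← eq_sub_iff_add_eq',
    ← fract_of_mem_cell hn hxc]
  refine fract_eq_of_sub_eq q.num ?_
  simp only [← hq, add_sub_cancel_left]
  exact_mod_cast q.den_mul_eq_num

/-- A right-locally translating map that conjugates a fibered irrational rotation of the cells
to another one permutes the cells. -/
lemma exists_cell_image {n : ℕ} (hn : 0 < n) {a b : Fin n → ℝ} {F F' h : Equiv.Perm I01}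
    (HF : CellAct n 1 a F) (ha : ∀ i, Irrational (a i)) (HF' : CellAct n 1 b F')
    (hh : h ∈ locTrans) (hc : ∀ x, h (F x) = F' (h x)) (i : Fin n) :
    ∃ j, ∀ x ∈ cell n i, h x ∈ cell n j := by
  have hn' : (0 : ℝ) < n := by exact_mod_cast hn
  choose φ hφ using fun x : I01 => exists_mem_cell hn (h x)
  obtain ⟨x₀, hx₀⟩ := exists_cell_point hn i 0
  have hx₀c := mem_cell_of_eq hn hx₀
  obtain ⟨ε, hε, H⟩ := hh.1 x₀
  have hj := (mem_cell_iff hn).1 (hφ x₀)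
  refine ⟨φ x₀, fun x hx => ?_⟩
  have : φ x = φ x₀ := by
    -- The second bound on `ε` stops `h y` before the right end of the cell of `h x₀`.
    refine eq_of_invariant hn HF (ha i) φ ?_ hx₀c
      (ε := min ε ((φ x₀ + 1) / n - h x₀)) (lt_min hε ?_) ?_ hx
    · intro x hx
      refine cell_unique hn (hφ (F x)) ?_
      rw [hc]
      exact HF'.mem hn (hφ x)
    · rw [sub_pos, lt_div_iff₀ hn']
      linarith
    · intro y _ hy1 hy2
      have hy3 := min_le_left ε ((φ x₀ + 1) / n - h x₀)
      have hy4 := min_le_right ε ((φ x₀ + 1) / n - h x₀)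
      have e := H y hy1 (by linarith)
      refine cell_unique hn (hφ y) ((mem_cell_iff hn).2 ⟨hj.1.trans ?_, ?_⟩)
      · gcongr
        have : (h x₀ : ℝ) ≤ h y := by linarith
        exact this
      · rw [mul_comm, ← lt_div_iff₀ hn']
        linarith
  rw [← this]
  exact hφ x

/-- A right-locally translating map that conjugates a fibered irrational rotation of the cells
to another one acts by a rotation on each cell. -/
lemma exists_angle {n : ℕ} (hn : 0 < n) {a b : Fin n → ℝ} {F F' h : Equiv.Perm I01}
    (HF : CellAct n 1 a F) (ha : ∀ i, Irrational (a i)) (HF' : CellAct n 1 b F')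
    (hh : h ∈ locTrans) (hc : ∀ x, h (F x) = F' (h x)) {i j : Fin n}
    (hij : ∀ x ∈ cell n i, h x ∈ cell n j) :
    ∃ c : ℝ, ∀ x ∈ cell n i, n * (h x : ℝ) = j + Int.fract (n * (x : ℝ) + c) := by
  obtain ⟨x₀, hx₀⟩ := exists_cell_point hn i 0
  have hx₀c := mem_cell_of_eq hn hx₀
  have hcpow : ∀ (k : ℕ) (x : I01), h ((F ^ k) x) = (F' ^ k) (h x) := by
    intro k
    induction k with
    | zero => simp
    | succ k ih =>
      intro x
      rw [pow_succ, pow_succ, Equiv.Perm.mul_apply, Equiv.Perm.mul_apply, ih, hc]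
  -- Modulo `1`, each application of `F` shifts the scaled displacement of `h` by `b j - a i`.
  have hstep : ∀ (k : ℕ) (x : I01), x ∈ cell n i → ∃ z : ℤ,
      n * ((h ((F ^ k) x) : ℝ) - (F ^ k) x) = n * (h x - x) + k * (b j - a i) + z := by
    intro k x hx
    rw [mul_sub, hcpow, HF'.pow hn k j _ (hij x hx), HF.pow hn k i x hx]
    refine ⟨(j : ℕ) - (i : ℕ) - ⌊n * (h x : ℝ) + k * b j⌋ + ⌊n * (x : ℝ) + k * a i⌋, ?_⟩
    rw [Int.fract, Int.fract]
    push_cast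
    simp only [id]
    ring
  -- There are finitely many displacements, so two coincide along the orbit of `x₀`, and a positive
  -- multiple of `b j - a i` is an integer. The displacement mod `1` is then invariant under `F ^ (q
  -- + 1)`, still an irrational rotation.
  obtain ⟨k, -, l, -, hkl, heq⟩ := Set.infinite_univ.exists_lt_map_eq_of_mapsTo
    (f := fun k : ℕ => (h ((F ^ k) x₀) : ℝ) - (F ^ k) x₀)
    (t := Set.range fun x : I01 => (h x : ℝ) - x) (fun k _ => ⟨(F ^ k) x₀, rfl⟩) hh.2
  obtain ⟨z, hz⟩ := hstep k x₀ hx₀c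
  obtain ⟨w, hw⟩ := hstep l x₀ hx₀c
  rw [heq, hw] at hz
  obtain ⟨q, rfl⟩ := Nat.exists_eq_add_of_lt hkl
  have hq : ((q + 1 : ℕ) : ℝ) * (b j - a i) = ((z - w : ℤ) : ℝ) := by
    push_cast at hz ⊢
    linarith
  obtain ⟨ε, hε, H⟩ := hh.1 x₀
  refine ⟨n * (h x₀ - x₀), fun x hx => ?_⟩
  have hirr : Irrational (((q + 1 : ℕ) : ℝ) * a i) := (ha i).natCast_mul (Nat.succ_ne_zero q)
  have := eq_of_invariant hn (HF.pow hn (q + 1)) (i := i) hirr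
    (fun x => Int.fract (n * ((h x : ℝ) - x))) (fun x hx => by
      obtain ⟨v, hv⟩ := hstep (q + 1) x hx
      refine fract_eq_of_sub_eq (v + (z - w)) ?_
      rw [hv, hq]
      push_cast
      ring) hx₀c hε (fun y _ h1 h2 => by rw [H y h1 h2]) hx
  obtain ⟨v, hv⟩ := Int.fract_eq_fract.1 this
  rw [← sub_eq_iff_eq_add', ← fract_of_mem_cell hn (hij x hx)]
  refine fract_eq_of_sub_eq v ?_
  rw [← hv]
  ring

/-- A further power `m` kills both cell permutations `σ` and `τ`, so that `h` conjugates one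
cellwise rotation to another, the first with irrational angles. -/
lemma mem_cellGroup_of_conj {n : ℕ} (hn : 0 < n) {f h : Equiv.Perm I01}
    (hf : f ∈ cellGroup n hn) (hp : PeriodicPointFree f) (hh : h ∈ locTrans) {k : ℕ}
    (hk : 0 < k) (hc : h * f ^ k * h⁻¹ ∈ cellGroup n hn) : h ∈ cellGroup n hn := by
  obtain ⟨σ, a, ha⟩ := (cellGroup n hn).pow_mem hf k
  obtain ⟨τ, b, hb⟩ := hc
  obtain ⟨m, hm, hσ, hτ⟩ : ∃ m : ℕ, 0 < m ∧ σ ^ m = 1 ∧ τ ^ m = 1 :=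
    ⟨orderOf σ * orderOf τ, Nat.mul_pos (orderOf_pos σ) (orderOf_pos τ),
      by rw [pow_mul, pow_orderOf_eq_one, one_pow],
      by rw [mul_comm, pow_mul, pow_orderOf_eq_one, one_pow]⟩
  obtain ⟨a', ha'⟩ := ha.pow_perm hn m
  obtain ⟨b', hb'⟩ := hb.pow_perm hn m
  rw [hσ] at ha'
  rw [hτ, conj_pow] at hb'
  have hirr := ha'.irrational hn fun l hl x => by
    rw [← pow_mul, ← pow_mul]
    exact hp.pow (by positivity) x
  have hc : ∀ x, h (((f ^ k) ^ m) x) = (h * (f ^ k) ^ m * h⁻¹) (h x) := by simp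
  choose s hs using exists_cell_image hn ha' hirr hb' hh hc
  choose c hc using fun i => exists_angle hn ha' hirr hb' hh hc (hs i)
  have hsurj : Function.Surjective s := by
    intro j
    obtain ⟨y, hy⟩ := exists_cell_point hn j 0
    obtain ⟨x, rfl⟩ := h.surjective y
    obtain ⟨i, hi⟩ := exists_mem_cell hn x
    exact ⟨i, cell_unique hn (hs i x hi) (mem_cell_of_eq hn hy)⟩
  exact ⟨Equiv.ofBijective s ⟨Finite.injective_iff_surjective.2 hsurj, hsurj⟩, c, hc⟩

/-! ### Group theory of virtual nilpotency -/

/-- If the subgroup `S` contains every element conjugating some positive power of `f ∈ S` into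
`S`, and the group is virtually nilpotent, then `S` is the whole group. -/
lemma eq_top_of_isVirtuallyNilpotent {Γ : Type*} [Group Γ] (hΓ : Group.IsVirtuallyNilpotent Γ)
    (S : Subgroup Γ) {f : Γ} (hf : f ∈ S)
    (h : ∀ g : Γ, ∀ k : ℕ, 0 < k → g * f ^ k * g⁻¹ ∈ S → g ∈ S) : S = ⊤ := by
  obtain ⟨N, ⟨m, hm⟩, hN⟩ := hΓ
  obtain ⟨k, hk, -, hfk⟩ := Subgroup.exists_pow_mem_of_index_ne_zero hN.index_ne_zero f
  have key : ∀ l : ℕ, ∀ g : N, g ∈ Subgroup.upperCentralSeries N l → (g : Γ) ∈ S := by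
    intro l
    induction l with
    | zero =>
      intro g hg
      rw [Subgroup.upperCentralSeries_zero, Subgroup.mem_bot] at hg
      simp [hg]
    | succ l ih =>
      intro g hg
      -- The commutator of `g` with `f ^ k` lies one step lower in the series, hence in `S`;
      -- multiplying by `f ^ k` puts the conjugate in `S`.
      have := ih _ (Subgroup.mem_upperCentralSeries_succ_iff.1 hg ⟨f ^ k, hfk⟩)
      refine h g k hk ?_
      have h2 := S.mul_mem this (S.pow_mem hf k)
      simpa [commutatorElement_def] using h2
  have hNS : N ≤ S := fun g hg => key m ⟨g, hg⟩ (by simp [hm])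
  rw [Subgroup.eq_top_iff']
  intro g
  -- Finite index puts a power of the conjugate `g * f * g⁻¹` in `N ≤ S`.
  obtain ⟨l, hl, -, hgl⟩ :=
    Subgroup.exists_pow_mem_of_index_ne_zero hN.index_ne_zero (g * f * g⁻¹)
  rw [conj_pow] at hgl
  exact h g l hl (hNS hgl)

lemma mem_cellGroup_of_isVirtuallyNilpotent {n : ℕ} (hn : 0 < n) {f g : Equiv.Perm I01}
    (hf : f ∈ cellGroup n hn) (hp : PeriodicPointFree f) (hft : f ∈ locTrans)
    (hg : g ∈ locTrans) (hv : Group.IsVirtuallyNilpotent (Subgroup.closure {f, g})) :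
    g ∈ cellGroup n hn := by
  have hle : Subgroup.closure {f, g} ≤ locTrans := by
    rw [Subgroup.closure_le]
    rintro _ (rfl | rfl) <;> assumption
  have hfm : f ∈ Subgroup.closure {f, g} := Subgroup.subset_closure (by simp)
  have hgm : g ∈ Subgroup.closure {f, g} := Subgroup.subset_closure (by simp)
  have := eq_top_of_isVirtuallyNilpotent hv
    ((cellGroup n hn).subgroupOf (Subgroup.closure {f, g})) (f := ⟨f, hfm⟩)
    (Subgroup.mem_subgroupOf.2 hf) (fun x k hk hx => by
      rw [Subgroup.mem_subgroupOf] at hx ⊢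
      exact mem_cellGroup_of_conj hn hf hp (hle x.2) hk (by simpa using hx))
  rw [Subgroup.subgroupOf_eq_top] at this
  exact this hgm

/-! ### Rotations as the case of one cell -/

lemma IsRotationBy.cellAct {α : ℝ} {f : Equiv.Perm I01} (h : IsRotationBy α f) :
    CellAct 1 1 (fun _ => α) f := by
  intro i x _
  simp [h x, Subsingleton.elim i 0]

lemma IsRotationBy.mem_locTrans {α : ℝ} {f : Equiv.Perm I01} (h : IsRotationBy α f) :
    f ∈ locTrans := by
  constructor
  · intro x
    refine ⟨1 - Int.fract ((x : ℝ) + α), by linarith [Int.fract_lt_one ((x : ℝ) + α)],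
      fun y h1 h2 => ?_⟩
    have : Int.fract ((y : ℝ) + α) = Int.fract ((x : ℝ) + α) + (y - x) := by
      rw [Int.fract_eq_iff]
      refine ⟨by linarith [Int.fract_nonneg ((x : ℝ) + α)], by linarith,
        ⌊(x : ℝ) + α⌋, ?_⟩
      rw [Int.fract]
      ring
    rw [h x, h y, this]
    ring
  · refine ((Set.finite_Icc (-1 - ⌈|α|⌉ : ℤ) (1 + ⌈|α|⌉)).image
      (fun z : ℤ => α + z)).subset ?_
    rintro _ ⟨x, rfl⟩
    refine ⟨-⌊(x : ℝ) + α⌋, ?_, ?_⟩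
    · have h1 := Int.floor_le ((x : ℝ) + α)
      have h2 := Int.lt_floor_add_one ((x : ℝ) + α)
      have h3 := Int.le_ceil |α|
      have h4 := le_abs_self α
      have h5 := neg_abs_le α
      have h6 := x.2.1
      have h7 := x.2.2
      have e1 : ((⌊(x : ℝ) + α⌋ : ℤ) : ℝ) ≤ ((1 + ⌈|α|⌉ : ℤ) : ℝ) := by
        push_cast; linarith
      have e2 : ((-1 - ⌈|α|⌉ : ℤ) : ℝ) ≤ ((⌊(x : ℝ) + α⌋ : ℤ) : ℝ) := by
        push_cast; linarith
      rw [Int.cast_le] at e1 e2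
      exact ⟨by linarith, by linarith⟩
    · simp only [h x, Int.fract]
      push_cast
      ring

lemma CellAct.isRotation {σ : Equiv.Perm (Fin 1)} {a : Fin 1 → ℝ} {g : Equiv.Perm I01}
    (h : CellAct 1 σ a g) : IsRotation g := by
  refine ⟨a 0, fun x => ?_⟩
  have hx : x ∈ cell 1 0 := (mem_cell_iff one_pos).2 (by simpa using ⟨x.2.1, x.2.2⟩)
  simpa [Subsingleton.elim (σ 0) 0] using h 0 x hx

lemma IsRotationBy.periodicPointFree {α : ℝ} {f : Equiv.Perm I01} (h : IsRotationBy α f)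
    (hα : Irrational α) : PeriodicPointFree f := by
  rw [PeriodicPointFree, Set.eq_empty_iff_forall_notMem]
  rintro x ⟨k, hk, hx⟩
  rw [Function.IsPeriodicPt, Function.IsFixedPt, Equiv.Perm.iterate_eq_pow] at hx
  have hxc : x ∈ cell 1 0 := (mem_cell_iff one_pos).2 (by simpa using ⟨x.2.1, x.2.2⟩)
  have e := h.cellAct.pow one_pos k 0 x hxc
  rw [hx, Equiv.Perm.one_apply, ← sub_eq_iff_eq_add', ← fract_of_mem_cell one_pos hxc] at e
  obtain ⟨z, hz⟩ := Int.fract_eq_fract.1 e.symm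
  rw [add_sub_cancel_left] at hz
  exact (hα.natCast_mul hk.ne').ne_int z hz

/-! ### Comparison of `G n` with `cellGroup n` -/

lemma ExchangesOn.exists_angle {n : ℕ} (hn : 0 < n) {h : Equiv.Perm I01} {i j : Fin n}
    (himg : h '' cell n i = cell n j) {r : ℕ} (hr : r ≤ 2)
    (H : ExchangesOn h ((i : ℝ) / n) (((i : ℝ) + 1) / n) r) :
    ∃ α : ℝ, ∀ x ∈ cell n i, n * (h x : ℝ) = j + Int.fract (n * (x : ℝ) + α) := by
  have hn' : (0 : ℝ) < n := by exact_mod_cast hn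
  have hab : (i : ℝ) / n < ((i : ℝ) + 1) / n := by gcongr; linarith
  obtain ⟨c, t, hc, hc0, hc1, ht⟩ := H
  have hmaps : ∀ x ∈ cell n i, (j : ℝ) ≤ n * (h x : ℝ) ∧ n * (h x : ℝ) < j + 1 := fun x hx =>
    (mem_cell_iff hn).1 (himg ▸ Set.mem_image_of_mem h hx)
  have hsurj : ∀ y ∈ cell n j, ∃ x ∈ cell n i, h x = y := fun y hy => by
    rw [← himg] at hy
    exact hy
  obtain ⟨x₀, hx₀⟩ := exists_cell_point hn i 0
  have hx₀c := mem_cell_of_eq hn hx₀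
  obtain ⟨y₀, hy₀⟩ := exists_cell_point hn j 0
  have hy₀c := mem_cell_of_eq hn hy₀
  rw [Int.fract_zero, add_zero] at hx₀ hy₀
  obtain ⟨w, hw, hwy⟩ := hsurj y₀ hy₀c
  have hwi := (mem_cell_iff hn).1 hw
  obtain rfl | rfl | rfl : r = 0 ∨ r = 1 ∨ r = 2 := by omega
  · exact absurd (hc0.symm.trans hc1) hab.ne
  · have key : ∀ x ∈ cell n i, n * (h x : ℝ) = n * x + n * t 0 := by
      intro x hx
      rw [ht 0 x (by rw [Fin.castSucc_zero, hc0]; exact hx.1)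
        (by rw [show (Fin.succ 0 : Fin 2) = Fin.last 1 from rfl, hc1]; exact hx.2)]
      ring
    have e1 := (hmaps x₀ hx₀c).1
    have e2 := key w hw
    rw [key x₀ hx₀c, hx₀] at e1
    rw [hwy, hy₀] at e2
    have e3 : (n : ℝ) * t 0 = j - i := by linarith
    refine ⟨0, fun x hx => ?_⟩
    rw [key x hx, e3, add_zero, fract_of_mem_cell hn hx]
    ring
  · have hd0 : (i : ℝ) < n * c 1 := by
      have := hc (show (0 : Fin 3) < 1 by decide)
      rw [hc0, div_lt_iff₀ hn'] at this
      linarith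
    have hd1 : (n : ℝ) * c 1 < i + 1 := by
      have := hc (show (1 : Fin 3) < Fin.last 2 by decide)
      rw [hc1, lt_div_iff₀ hn'] at this
      linarith
    have key0 : ∀ x ∈ cell n i, n * (x : ℝ) < n * c 1 → n * (h x : ℝ) = n * x + n * t 0 := by
      intro x hx hlt
      rw [ht 0 x (by rw [Fin.castSucc_zero, hc0]; exact hx.1)
        (lt_of_mul_lt_mul_left hlt hn'.le)]
      ring
    have key1 : ∀ x ∈ cell n i, n * c 1 ≤ n * (x : ℝ) → n * (h x : ℝ) = n * x + n * t 1 := by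
      intro x hx hle
      rw [ht 1 x (le_of_mul_le_mul_left hle hn')
        (by rw [show (Fin.succ 1 : Fin 3) = Fin.last 2 from rfl, hc1]; exact hx.2)]
      ring
    generalize (n : ℝ) * c 1 = d at hd0 hd1 key0 key1
    generalize (n : ℝ) * t 0 = s at key0
    generalize (n : ℝ) * t 1 = u at key1
    obtain ⟨xd, hxd⟩ := exists_cell_point hn i d
    have hxdc := mem_cell_of_eq hn hxd
    have hfd : Int.fract d = d - i := by
      rw [Int.fract_eq_iff]
      exact ⟨by linarith, by linarith, i, by push_cast; ring⟩
    rw [hfd, add_sub_cancel] at hxd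
    have ex0 := key0 x₀ hx₀c (by linarith)
    have exd := key1 xd hxdc hxd.ge
    have bx0 := (hmaps x₀ hx₀c).1
    have bxd := (hmaps xd hxdc).1
    rw [ex0, hx₀] at bx0
    rw [exd, hxd] at bxd
    have hne : ∀ x ∈ cell n i, ∀ y ∈ cell n i, n * (x : ℝ) < d → d ≤ n * (y : ℝ) →
        n * (x : ℝ) + s ≠ n * y + u := by
      intro x hx y hy h1 h2 h3
      rw [← key0 x hx h1, ← key1 y hy h2] at h3
      have := h.injective (eq_of_mul_eq hn h3)
      rw [this] at h1
      exact absurd h1 (not_lt.2 h2)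
    -- Which piece covers the left end of the target cell decides whether the order is kept (angle
    -- `0`) or swapped (angle `-d`). In each case `p` is the right end of that piece's image, so it
    -- is covered by the other piece; a gap would make the images overlap.
    rcases lt_or_ge (n * (w : ℝ)) d with hwd | hwd
    · have ew := key0 w hw hwd
      rw [hwy, hy₀] at ew
      have hs : s = j - i := by linarith
      obtain ⟨p, hp⟩ := exists_cell_point hn j (d - i)
      have hpc := mem_cell_of_eq hn hp
      rw [Int.fract_eq_self.2 ⟨by linarith, by linarith⟩] at hp
      obtain ⟨v, hv, hvp⟩ := hsurj p hpc
      have hvi := (mem_cell_iff hn).1 hv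
      have hvd : d ≤ n * (v : ℝ) := by
        by_contra! hlt
        have := key0 v hv hlt
        rw [hvp, hp] at this
        linarith
      have ev := key1 v hv hvd
      rw [hvp, hp] at ev
      have hu : u = j - i := by
        refine le_antisymm (by linarith) ?_
        by_contra! hlt
        obtain ⟨z, hz⟩ := exists_cell_point hn i (d + u - j)
        have hzc := mem_cell_of_eq hn hz
        rw [Int.fract_eq_self.2 ⟨by linarith, by linarith⟩] at hz
        exact hne z hzc xd hxdc (by linarith) hxd.ge (by rw [hz, hxd, hs]; ring)
      refine ⟨0, fun x hx => ?_⟩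
      rw [add_zero, fract_of_mem_cell hn hx]
      rcases lt_or_ge (n * (x : ℝ)) d with hxd | hxd
      · rw [key0 x hx hxd, hs]
        ring
      · rw [key1 x hx hxd, hu]
        ring
    · have ew := key1 w hw hwd
      rw [hwy, hy₀] at ew
      have hu : u = j - d := by linarith
      obtain ⟨p, hp⟩ := exists_cell_point hn j (i + 1 - d)
      have hpc := mem_cell_of_eq hn hp
      rw [Int.fract_eq_self.2 ⟨by linarith, by linarith⟩] at hp
      obtain ⟨v, hv, hvp⟩ := hsurj p hpc
      have hvi := (mem_cell_iff hn).1 hv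
      have hvd : n * (v : ℝ) < d := by
        by_contra! hle
        have := key1 v hv hle
        rw [hvp, hp] at this
        linarith
      have ev := key0 v hv hvd
      rw [hvp, hp] at ev
      have hs : s = j + 1 - d := by
        refine le_antisymm (by linarith) ?_
        by_contra! hlt
        obtain ⟨z, hz⟩ := exists_cell_point hn i (s + d - j)
        have hzc := mem_cell_of_eq hn hz
        rw [Int.fract_eq_self.2 ⟨by linarith, by linarith⟩] at hz
        exact hne x₀ hx₀c z hzc (by linarith) (by linarith) (by rw [hz, hx₀, hu]; ring)
      refine ⟨-d, fun x hx => ?_⟩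
      have hxi := (mem_cell_iff hn).1 hx
      rw [← sub_eq_iff_eq_add', eq_comm, Int.fract_eq_iff]
      rcases lt_or_ge (n * (x : ℝ)) d with hxd | hxd
      · rw [key0 x hx hxd, hs]
        exact ⟨by linarith, by linarith, -1, by push_cast; ring⟩
      · rw [key1 x hx hxd, hu]
        exact ⟨by linarith, by linarith, 0, by push_cast; ring⟩

lemma mem_cellGroup_of_mem_G {n : ℕ} (hn : 0 < n) {h : Equiv.Perm I01} (H : h ∈ G n) :
    h ∈ cellGroup n hn := by
  obtain ⟨-, H⟩ := H
  choose s hs using fun i => (H i).1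
  have hangle : ∀ i, ∃ α : ℝ, ∀ x ∈ cell n i,
      n * (h x : ℝ) = s i + Int.fract (n * (x : ℝ) + α) := fun i => by
    obtain ⟨r, hr, he⟩ := (H i).2
    exact he.exists_angle hn (hs i) hr
  choose a ha using hangle
  have hinj : Function.Injective s := by
    intro i j hij
    have : cell n i = cell n j := h.injective.image_injective (by rw [hs, hs, hij])
    obtain ⟨x, hx⟩ := exists_cell_point hn i 0
    have hx := mem_cell_of_eq hn hx
    exact cell_unique hn hx (this ▸ hx)
  exact ⟨Equiv.ofBijective s ⟨hinj, Finite.injective_iff_surjective.1 hinj⟩, a, ha⟩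

lemma CellAct.exchangesOn {n : ℕ} (hn : 0 < n) {σ : Equiv.Perm (Fin n)} {a : Fin n → ℝ}
    {h : Equiv.Perm I01} (H : CellAct n σ a h) (i : Fin n) :
    ∃ r ≤ 2, ExchangesOn h ((i : ℝ) / n) (((i : ℝ) + 1) / n) r := by
  have hn' : (0 : ℝ) < n := by exact_mod_cast hn
  have hab : (i : ℝ) / n < ((i : ℝ) + 1) / n := by gcongr; linarith
  have key : ∀ x ∈ cell n i,
      n * (h x : ℝ) = σ i + Int.fract (n * (x : ℝ) - i + Int.fract (a i)) := by
    intro x hx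
    rw [H i x hx]
    congr 1
    refine fract_eq_of_sub_eq ((i : ℕ) + ⌊a i⌋) ?_
    rw [Int.fract]
    push_cast
    ring
  have hβ0 := Int.fract_nonneg (a i)
  have hβ1 := Int.fract_lt_one (a i)
  generalize Int.fract (a i) = β at key hβ0 hβ1
  have lo : ∀ x ∈ cell n i, n * (x : ℝ) < i + 1 - β →
      (h x : ℝ) = x + ((σ i : ℝ) - i + β) / n := by
    intro x hx hlt
    have hxi := (mem_cell_iff hn).1 hx
    have := key x hx
    rw [Int.fract_eq_self.2 ⟨by linarith, by linarith⟩] at this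
    field_simp
    linarith
  -- The cut is at `(i + 1 - β) / n`; for `β = 0` the second piece would be empty, which strict
  -- monotonicity forbids.
  rcases hβ0.eq_or_lt with rfl | hβ
  · refine ⟨1, by norm_num, ![(i : ℝ) / n, ((i : ℝ) + 1) / n], fun _ => ((σ i : ℝ) - i + 0) / n,
      ?_, rfl, rfl, ?_⟩
    · rw [Fin.strictMono_iff_lt_succ]
      intro k
      fin_cases k
      exact hab
    · intro k x h1 h2
      fin_cases k
      have hx : x ∈ cell n i := ⟨h1, h2⟩
      exact lo x hx (by linarith [((mem_cell_iff hn).1 hx).2])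
  · refine ⟨2, le_rfl, ![(i : ℝ) / n, ((i : ℝ) + 1 - β) / n, ((i : ℝ) + 1) / n],
      ![((σ i : ℝ) - i + β) / n, ((σ i : ℝ) - i + β - 1) / n], ?_, rfl, rfl, ?_⟩
    · rw [Fin.strictMono_iff_lt_succ]
      intro k
      fin_cases k
      · change (i : ℝ) / n < ((i : ℝ) + 1 - β) / n
        gcongr
        linarith
      · change ((i : ℝ) + 1 - β) / n < ((i : ℝ) + 1) / n
        gcongr
        linarith
    · intro k x h1 h2
      fin_cases k
      · change (i : ℝ) / n ≤ x at h1
        change (x : ℝ) < ((i : ℝ) + 1 - β) / n at h2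
        rw [lt_div_iff₀ hn'] at h2
        rw [div_le_iff₀ hn'] at h1
        exact lo x ((mem_cell_iff hn).2 ⟨by linarith, by linarith⟩) (by linarith)
      · change ((i : ℝ) + 1 - β) / n ≤ x at h1
        change (x : ℝ) < ((i : ℝ) + 1) / n at h2
        rw [lt_div_iff₀ hn'] at h2
        rw [div_le_iff₀ hn'] at h1
        have := key x ((mem_cell_iff hn).2 ⟨by linarith, by linarith⟩)
        have hfr : Int.fract (n * (x : ℝ) - i + β) = n * (x : ℝ) - i + β - 1 := by
          rw [Int.fract_eq_iff]
          exact ⟨by linarith, by linarith, 1, by push_cast; ring⟩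
        rw [hfr] at this
        change (h x : ℝ) = x + ((σ i : ℝ) - i + β - 1) / n
        field_simp
        linarith

lemma IsIET.mem_G {n : ℕ} (hn : 0 < n) {h : Equiv.Perm I01} (hI : IsIET h)
    (H : h ∈ cellGroup n hn) : h ∈ G n := by
  obtain ⟨σ, a, H⟩ := H
  refine ⟨hI, fun i => ⟨⟨σ i, Set.Subset.antisymm ?_ ?_⟩, H.exchangesOn hn i⟩⟩
  · rintro _ ⟨x, hx, rfl⟩
    exact H.mem hn hx
  · intro y hy
    refine ⟨h⁻¹ y, ?_, by simp⟩
    simpa using (H.inv hn).mem hn hy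

end IET
theorem corollary3 :
    (∀ f g : Equiv.Perm IET.I01,
      IET.IsIrrationalRotation f → IET.IsIET g → ¬ IET.IsRotation g →
        ¬ Group.IsVirtuallyNilpotent (Subgroup.closure {f, g})) ∧
    (∀ n : ℕ, 0 < n → ∀ f g : Equiv.Perm IET.I01,
      f ∈ IET.G n → IET.PeriodicPointFree f → IET.IsIET g → g ∉ IET.G n →
        ¬ Group.IsVirtuallyNilpotent (Subgroup.closure {f, g})) := by
  refine ⟨?_, ?_⟩
  · rintro f g ⟨α, hα, hf⟩ hg hng hv
    obtain ⟨σ, a, h⟩ := IET.mem_cellGroup_of_isVirtuallyNilpotent one_pos ⟨1, _, hf.cellAct⟩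
      (hf.periodicPointFree hα) hf.mem_locTrans hg.mem_locTrans hv
    exact hng h.isRotation
  · intro n hn f g hf hp hg hng hv
    exact hng (hg.mem_G hn (IET.mem_cellGroup_of_isVirtuallyNilpotent hn
      (IET.mem_cellGroup_of_mem_G hn hf) hp hf.1.mem_locTrans hg.mem_locTrans hv))
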